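/- Let $\mathbb{D}=\{z\in\mathbb{C}:|z|<1\}$. Let $Bel(\mathbb{D})$ be the Banach space of (a.e. equivalence classes of) essentially bounded measurable functions $\mu:\mathbb{D}\to\mathbb{C}$ with the norm $\|\mu\|_\infty$, and let $Q(\mathbb{D})$ be the space of holomorphic functions $\varphi$ on $\mathbb{D}$ with $\|\varphi\|=\iint_{\mathbb{D}}|\varphi|\,dx\,dy<\infty$. Call $\mu,\nu\in Bel(\mathbb{D})$ (infinitesimally Teichmüller) equivalent if $\iint_{\mathbb{D}}(\mu-\nu)\varphi\,dx\,dy=0$ for all $\varphi\in Q(\mathbb{D})$, and let $[\mu]$ be the equivalence class of $\mu$. For $\mu\in Bel(\mathbb{D})$ say that: - $\mu$ is *extremal* if $\|\mu\|_\infty=\sup\{\operatorname{Re}\iint_{\mathbb{D}}\mu\varphi\,dx\,dy:\varphi\in Q(\mathbb{D}),\ \|\varphi\|=1\}$; - $\mu$ is *non-decreasable* if $\nu\in[\mu]$ and $|\nu|\le|\mu|$ a.e. in $\mathbb{D}$ imply $\nu=\mu$; - $\mu$ is *strongly decreasable* if there are $\nu\in[\mu]$ with $|\nu|\le|\mu|$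 a.e. in $\mathbb{D}$, a (nonempty) domain $G\subset\mathbb{D}$ and $\delta>0$ such that $|\nu|\le|\mu|-\delta$ a.e. in $G$; - $\mu$ is *pseudo non-decreasable* if it is neither strongly decreasable nor non-decreasable. Theorem. There exists an extremal $\mu\in Bel(\mathbb{D})$ such that $[\mu]$ contains infinitely many elements that are extremal and non-decreasable, and $[\mu]$ also contains infinitely many elements that are extremal and pseudo non-decreasable. -/

import Mathlib

open MeasureTheory

namespace InfTeich

/-- The Banach space of Beltrami differentials on `S ⊆ ℂ`: essentially bounded measurable
functions on `S` modulo a.e. equality, with the `L^∞` norm. -/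
abbrev Bel (S : Set ℂ) : Type := Lp ℂ ⊤ (volume.restrict S)

/-- `φ` is an integrable holomorphic quadratic differential on `S`, i.e. `φ ∈ Q(S)`. -/
def IsQuadDiff (S : Set ℂ) (φ : ℂ → ℂ) : Prop :=
  DifferentiableOn ℂ φ S ∧ IntegrableOn φ S volume

/-- Infinitesimal Teichmüller equivalence of Beltrami differentials. -/
def Equivalent {S : Set ℂ} (μ ν : Bel S) : Prop :=
  ∀ φ : ℂ → ℂ, IsQuadDiff S φ → ∫ z in S, (μ z - ν z) * φ z = 0

/-- The infinitesimal equivalence class `[μ]`. -/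
def eqClass {S : Set ℂ} (μ : Bel S) : Set (Bel S) := {ν | Equivalent μ ν}

/-- The norm of `[μ]`: the supremum of `Re ∫ μ φ` over the unit sphere of `Q(S)`. -/
noncomputable def classNorm {S : Set ℂ} (μ : Bel S) : ℝ :=
  sSup {t : ℝ | ∃ φ : ℂ → ℂ, IsQuadDiff S φ ∧ ∫ z in S, ‖φ z‖ = 1 ∧
    t = (∫ z in S, μ z * φ z).re}

/-- `μ` is extremal in its class. -/
def IsExtremal {S : Set ℂ} (μ : Bel S) : Prop := ‖μ‖ = classNorm μ

/-- `μ` is non-decreasable in its class. -/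
def IsNonDecreasable {S : Set ℂ} (μ : Bel S) : Prop :=
  ∀ ν ∈ eqClass μ, (∀ᵐ z ∂volume.restrict S, ‖ν z‖ ≤ ‖μ z‖) → μ = ν

/-- `μ` is strongly decreasable in its class; a domain is a nonempty connected open set. -/
def IsStronglyDecreasable {S : Set ℂ} (μ : Bel S) : Prop :=
  ∃ ν ∈ eqClass μ, (∀ᵐ z ∂volume.restrict S, ‖ν z‖ ≤ ‖μ z‖) ∧
    ∃ G : Set ℂ, G ⊆ S ∧ IsOpen G ∧ IsConnected G ∧
      ∃ δ : ℝ, 0 < δ ∧ ∀ᵐ z ∂volume.restrict G, ‖ν z‖ ≤ ‖μ z‖ - δ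

/-- `μ` is weakly non-decreasable in its class. -/
def IsWeaklyNonDecreasable {S : Set ℂ} (μ : Bel S) : Prop := ¬ IsStronglyDecreasable μ

/-- `μ` is a pseudo non-decreasable dilatation: weakly non-decreasable, not non-decreasable. -/
def IsPseudoNonDecreasable {S : Set ℂ} (μ : Bel S) : Prop :=
  IsWeaklyNonDecreasable μ ∧ ¬ IsNonDecreasable μ

/-- The open unit disk. -/
abbrev disk : Set ℂ := Metric.ball (0 : ℂ) 1

end InfTeich

/-!
The construction is governed by the quadratic differential `φ = (1 - z)⁻²`, which just fails to be
integrable, and by its integrable neighbours `(1 - z) ^ (ε - 2)`, `ε > 0`, whose norms are comparable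
to `1 / ε`.

* Extremality (`isExtremal_twist`). If `|g| ≤ 1` and `g = 1` off a set on which `φ` is integrable,
  then `g · φ̄ / |φ|` is extremal: the normalised neighbours of `φ` concentrate at the boundary point
  `1` and are a Hamilton sequence.
* Non-decreasability (`isNonDecreasable_twist`). If `0 ≤ h ≤ 1`, then `h · φ̄ / |φ|` is
  non-decreasable. For integrable `φ` this would follow by testing with `φ` itself; here the
  neighbours of `φ` are used, and the error they cause tends to zero with `ε`.
* Equivalence (`IsSparseDense.equivalent_family`). If `p` is bounded and radial, has mean zero and is
  supported in a smaller disk, then `p / φ = (p / |φ|) · φ̄ / |φ|` is infinitesimally trivial, since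
  `∫ p ψ / φ = (ψ / φ)(0) ∫ p` for holomorphic `ψ`, by the mean value property.

Let `Z` be an open dense radial subset of the disk, so thin that `φ` is integrable on it. Take
`h₀ = 0` on `Z`, `h₀ = 1 / 2` on the rest of `ball 0 (1 / 2)` and `h₀ = 1` elsewhere, and let `p` be
as above, real and supported in `ball 0 (1 / 2) \ Z`. All differentials
`(h₀ + c p / |φ|) · φ̄ / |φ|`, with `c` complex and `|c| ≤ 1 / 2`, are equivalent and extremal. If
`c ≥ 0`, the coefficient is nonnegative and the differential is non-decreasable. If `c` is imaginary
and not zero, the modulus of the coefficient is at least `h₀`, so the differential can be decreased to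
the one with `c = 0`. It is not strongly decreasable, because it vanishes on `Z`, which meets every
open subset of the disk in positive area.
-/

namespace InfTeich

open Set Metric

/-! ### Norms of powers of `1 - z` on the disk -/

lemma integrableOn_ball_norm_rpow {ε : ℝ} (hε : 0 < ε) (R : ℝ) :
    IntegrableOn (fun w : ℂ => ‖w‖ ^ (ε - 2)) (ball 0 R) := by
  rw [integrableOn_fun_norm_addHaar volume (f := fun r : ℝ => r ^ (ε - 2))]
  rcases le_or_gt R 0 with hR | hR
  · simp [Ioo_eq_empty (not_lt.2 hR)]
  refine ((intervalIntegral.integrableOn_Ioo_rpow_iff hR (s := ε - 1)).2 (by linarith)).congr_fun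
    (fun r hr => ?_) measurableSet_Ioo
  have : ε - 1 = 1 + (ε - 2) := by ring
  simp [this, Real.rpow_add hr.1]

lemma integral_ball_norm_rpow {ε R : ℝ} (hε : 0 < ε) (hR : 0 ≤ R) :
    ∫ w in ball (0 : ℂ) R, ‖w‖ ^ (ε - 2) = 2 * Real.pi * (R ^ ε / ε) := by
  have h1 : ∀ w : ℂ, (ball (0 : ℂ) R).indicator (fun w => ‖w‖ ^ (ε - 2)) w
      = (Iio R).indicator (fun r : ℝ => r ^ (ε - 2)) ‖w‖ := by
    intro w; simp [indicator]
  rw [← integral_indicator measurableSet_ball, integral_congr_ae (ae_of_all _ h1),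
    integral_fun_norm_addHaar]
  have h2 : ∫ y in Ioi (0 : ℝ), y ^ (Module.finrank ℝ ℂ - 1) •
      (Iio R).indicator (fun r : ℝ => r ^ (ε - 2)) y = R ^ ε / ε := by
    have h3 : ∀ y ∈ Ioi (0 : ℝ), y ^ (Module.finrank ℝ ℂ - 1) •
        (Iio R).indicator (fun r : ℝ => r ^ (ε - 2)) y =
        (Iio R).indicator (fun r : ℝ => r ^ (ε - 1)) y := by
      intro y hy
      have : ε - 1 = 1 + (ε - 2) := by ring
      by_cases h : y < R <;> simp [indicator, h, this, Real.rpow_add (mem_Ioi.1 hy)]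
    rw [setIntegral_congr_fun measurableSet_Ioi h3, setIntegral_indicator measurableSet_Iio,
      Ioi_inter_Iio, ← integral_Ioc_eq_integral_Ioo, ← intervalIntegral.integral_of_le hR,
      integral_rpow (Or.inl (by linarith))]
    simp [Real.zero_rpow hε.ne']
  rw [h2]
  simp [Measure.real, mul_assoc]

/-- The four rotations of the disk `ball 1 1` by multiples of a right angle cover the punctured
unit disk. -/
lemma ball_subset_iUnion_rotate :
    ball (0 : ℂ) 1 \ {0} ⊆ ⋃ k : Fin 4, (fun w : ℂ => Complex.I ^ (k : ℕ) * w) ⁻¹' ball 1 1 := by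
  rintro ⟨x, y⟩ ⟨h, h0⟩
  have key : ∀ w : ℂ, w ∈ ball (1 : ℂ) 1 ↔ w.re ^ 2 + w.im ^ 2 < 2 * w.re := by
    intro w
    rw [mem_ball, Complex.dist_eq, ← sq_lt_one_iff₀ (norm_nonneg _), Complex.sq_norm,
      Complex.normSq_apply]
    simp only [Complex.sub_re, Complex.sub_im, Complex.one_re, Complex.one_im]
    constructor <;> intro h <;> linarith
  have h1 : x ^ 2 + y ^ 2 < 1 := by
    rw [mem_ball_zero_iff, ← sq_lt_one_iff₀ (norm_nonneg _), Complex.sq_norm,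
      Complex.normSq_apply] at h
    simp only at h; linarith
  have h2 : 0 < x ^ 2 + y ^ 2 := by
    by_contra! hc
    have hx : x = 0 := by nlinarith
    have hy : y = 0 := by nlinarith
    exact h0 (by simp [hx, hy, Complex.ext_iff])
  simp only [mem_iUnion, mem_preimage, key]
  have h3 : x ^ 2 + y ^ 2 < 2 * x ∨ x ^ 2 + y ^ 2 < 2 * (-y) ∨ x ^ 2 + y ^ 2 < 2 * (-x) ∨
      x ^ 2 + y ^ 2 < 2 * y := by
    have hs : x ^ 2 + y ^ 2 < 2 * |x| ∨ x ^ 2 + y ^ 2 < 2 * |y| := by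
      by_contra! hc
      have := abs_nonneg x
      have := abs_nonneg y
      nlinarith [sq_abs x, sq_abs y]
    rcases hs with hs | hs
    · rcases abs_cases x with ⟨h, _⟩ | ⟨h, _⟩ <;> rw [h] at hs <;> tauto
    · rcases abs_cases y with ⟨h, _⟩ | ⟨h, _⟩ <;> rw [h] at hs <;> tauto
  rcases h3 with h | h | h | h
  · exact ⟨0, by simpa using h⟩
  · exact ⟨1, by simp; linarith⟩
  · exact ⟨2, by simp; linarith⟩
  · exact ⟨3, by simp [pow_succ]; linarith⟩

/-- Multiplication by a power of `I` preserves integrals of functions of the modulus. -/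
lemma setIntegral_preimage_rotate (f : ℝ → ℝ) (s : Set ℂ) (k : ℕ) :
    ∫ w in (fun w : ℂ => Complex.I ^ k * w) ⁻¹' s, f ‖w‖ = ∫ w in s, f ‖w‖ := by
  let c : Circle := ⟨Complex.I ^ k, by simp [Submonoid.unitSphere]⟩
  have := (rotation c).measurePreserving.setIntegral_preimage_emb
    (rotation c).toHomeomorph.measurableEmbedding (fun w => f ‖w‖) s
  have hc : (fun w : ℂ => Complex.I ^ k * w) = rotation c := by ext w; rw [rotation_apply]
  rw [hc]
  simpa only [LinearIsometryEquiv.norm_map] using this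

lemma setIntegral_disk_one_sub (f : ℂ → ℝ) :
    ∫ z in disk, f (1 - z) = ∫ w in ball 1 1, f w := by
  have := (Measure.measurePreserving_sub_left volume (1 : ℂ)).setIntegral_preimage_emb
    (Homeomorph.subLeft (1 : ℂ)).measurableEmbedding f (ball 1 1)
  rw [← this]
  congr 2
  ext z; simp

lemma integrableOn_disk_norm_rpow {ε : ℝ} (hε : 0 < ε) :
    IntegrableOn (fun z : ℂ => ‖1 - z‖ ^ (ε - 2)) disk := by
  have := (Measure.measurePreserving_sub_left volume (1 : ℂ)).integrableOn_comp_preimage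
    (Homeomorph.subLeft (1 : ℂ)).measurableEmbedding (s := ball 0 2)
    (f := fun w : ℂ => ‖w‖ ^ (ε - 2))
  refine (this.2 (integrableOn_ball_norm_rpow hε 2)).mono_set fun z hz => ?_
  have h := norm_sub_le (1 : ℂ) z
  rw [mem_ball_zero_iff] at hz
  rw [norm_one] at h
  simp only [mem_preimage, mem_ball_zero_iff]
  linarith

lemma integral_disk_norm_rpow_le {ε : ℝ} (hε : 0 < ε) (hε1 : ε ≤ 1) :
    ∫ z in disk, ‖1 - z‖ ^ (ε - 2) ≤ 4 * Real.pi / ε := by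
  rw [setIntegral_disk_one_sub (fun w => ‖w‖ ^ (ε - 2))]
  calc ∫ w in ball (1 : ℂ) 1, ‖w‖ ^ (ε - 2) ≤ ∫ w in ball (0 : ℂ) 2, ‖w‖ ^ (ε - 2) := by
        refine setIntegral_mono_set (integrableOn_ball_norm_rpow hε 2)
          (ae_of_all _ fun w => by positivity) (LE.le.eventuallyLE ?_)
        exact ball_subset_ball' (by simp; norm_num)
    _ = 2 * Real.pi * (2 ^ ε / ε) := integral_ball_norm_rpow hε zero_le_two
    _ ≤ 4 * Real.pi / ε := by
        have : (2 : ℝ) ^ ε ≤ 2 := by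
          simpa using Real.rpow_le_rpow_of_exponent_le one_le_two hε1
        rw [mul_div_assoc', div_le_div_iff_of_pos_right hε]
        nlinarith [Real.pi_pos]

/-- The `L¹` norms of the powers `(1 - z) ^ (ε - 2)` blow up as `ε → 0`. Four rotated copies of
`ball 1 1` cover the unit disk, which reduces the estimate to a radial integral. -/
lemma le_integral_disk_norm_rpow {ε : ℝ} (hε : 0 < ε) :
    1 / ε ≤ ∫ z in disk, ‖1 - z‖ ^ (ε - 2) := by
  rw [setIntegral_disk_one_sub (fun w => ‖w‖ ^ (ε - 2))]
  set s : Fin 4 → Set ℂ := fun k => (fun w : ℂ => Complex.I ^ (k : ℕ) * w) ⁻¹' ball 1 1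
  have hs : ∀ k, s k ⊆ ball 0 2 := by
    intro k w hw
    have hw' : ‖Complex.I ^ (k : ℕ) * w - 1‖ < 1 := by simpa [s, Complex.dist_eq] using hw
    have h := norm_sub_norm_le (Complex.I ^ (k : ℕ) * w) 1
    simp at h
    rw [mem_ball_zero_iff]; linarith
  have hsm : ∀ k, MeasurableSet (s k) := fun k =>
    (isOpen_ball.preimage (by fun_prop)).measurableSet
  have hint : ∀ k, IntegrableOn (fun w : ℂ => ‖w‖ ^ (ε - 2)) (s k) := fun k =>
    (integrableOn_ball_norm_rpow hε 2).mono_set (hs k)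
  have hnn : ∀ w : ℂ, 0 ≤ ‖w‖ ^ (ε - 2) := fun w => by positivity
  have h1 : ∫ w in ball (0 : ℂ) 1, ‖w‖ ^ (ε - 2) ≤
      ∑ k : Fin 4, ∫ w in s k, ‖w‖ ^ (ε - 2) := by
    have h2 : ∀ k, ∫ w in s k, ‖w‖ ^ (ε - 2) =
        ∫ w, (s k).indicator (fun w : ℂ => ‖w‖ ^ (ε - 2)) w := fun k =>
      (integral_indicator (hsm k)).symm
    rw [← integral_indicator measurableSet_ball, Finset.sum_congr rfl fun k _ => h2 k,
      ← integral_finsetSum _ fun k _ => (integrable_indicator_iff (hsm k)).2 (hint k)]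
    refine integral_mono_ae
      ((integrable_indicator_iff measurableSet_ball).2 (integrableOn_ball_norm_rpow hε 1))
      (integrable_finsetSum _ fun k _ => (integrable_indicator_iff (hsm k)).2 (hint k)) ?_
    have h0 : ∀ᵐ w : ℂ, w ≠ 0 := by simp [ae_iff]
    filter_upwards [h0] with w hw
    by_cases hwb : w ∈ ball (0 : ℂ) 1
    · obtain ⟨k, hk⟩ := mem_iUnion.1 (ball_subset_iUnion_rotate ⟨hwb, hw⟩)
      rw [indicator_of_mem hwb]
      calc ‖w‖ ^ (ε - 2) = (s k).indicator (fun w : ℂ => ‖w‖ ^ (ε - 2)) w :=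
            (indicator_of_mem (s := s k) hk (fun w : ℂ => ‖w‖ ^ (ε - 2))).symm
        _ ≤ _ := Finset.single_le_sum
            (f := fun k => (s k).indicator (fun w : ℂ => ‖w‖ ^ (ε - 2)) w)
            (fun k _ => indicator_nonneg (fun w _ => hnn w) w) (Finset.mem_univ k)
    · rw [indicator_of_notMem hwb]
      exact Finset.sum_nonneg fun k _ => indicator_nonneg (fun w _ => hnn w) w
  have h2 : ∀ k, ∫ w in s k, ‖w‖ ^ (ε - 2) = ∫ w in ball (1 : ℂ) 1, ‖w‖ ^ (ε - 2) := fun k =>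
    setIntegral_preimage_rotate (fun r => r ^ (ε - 2)) (ball 1 1) k
  rw [integral_ball_norm_rpow hε zero_le_one, Finset.sum_congr rfl fun k _ => h2 k] at h1
  simp only [Real.one_rpow, Finset.sum_const, Finset.card_univ, Fintype.card_fin,
    nsmul_eq_mul, Nat.cast_ofNat] at h1
  have : 0 < 1 / ε := by positivity
  nlinarith [Real.pi_gt_three]

/-! ### A thin open dense set -/

/-- A dense open subset of the disk, invariant under rotations, on which `|1 - z|⁻²` is integrable
and which leaves out a part of `ball 0 (1 / 2)` of positive area. -/
structure IsSparseDense (Z : Set ℂ) : Prop where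
  subset : Z ⊆ disk
  isOpen : IsOpen Z
  mem_of_norm_eq : ∀ z ∈ Z, ∀ w : ℂ, ‖w‖ = ‖z‖ → w ∈ Z
  dense : ∀ G : Set ℂ, IsOpen G → G.Nonempty → G ⊆ disk → (G ∩ Z).Nonempty
  integrableOn : IntegrableOn (fun z : ℂ => (‖1 - z‖ ^ 2)⁻¹) Z
  volume_ne_zero : volume (ball (0 : ℂ) (1 / 2) \ Z) ≠ 0

/-- The measure `(1 - |z|)⁻² dx dy` on the disk, pushed forward under `z ↦ (1 - |z|)⁻¹`, is locally
finite on the line and has no atoms. Hence a countable dense set of radii has an open neighbourhood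
of small measure; its preimage is the required set. -/
lemma exists_isSparseDense : ∃ Z, IsSparseDense Z := by
  let s : ℂ → ℝ := fun z => (1 - ‖z‖)⁻¹
  have hsm : Measurable s := by fun_prop
  let m : Measure ℝ := ((volume.restrict disk).withDensity
    fun z => ENNReal.ofReal (s z ^ 2)).map s
  have hm : ∀ t : Set ℝ, MeasurableSet t →
      m t = ∫⁻ z in s ⁻¹' t ∩ disk, ENNReal.ofReal (s z ^ 2) := by
    intro t ht
    rw [Measure.map_apply hsm ht, withDensity_apply _ (hsm ht), Measure.restrict_restrict (hsm ht)]
  have hdisk : ∀ z ∈ disk, 0 < 1 - ‖z‖ := by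
    intro z hz
    rw [mem_ball_zero_iff] at hz; linarith
  have hs1 : ∀ z ∈ disk, 1 ≤ s z := by
    intro z hz
    exact (one_le_inv₀ (hdisk z hz)).2 (by linarith [norm_nonneg z])
  have hfin : IsLocallyFiniteMeasure m := by
    refine ⟨fun x => ⟨Iio (x + 1), Iio_mem_nhds (by linarith), ?_⟩⟩
    rw [hm _ measurableSet_Iio]
    calc ∫⁻ z in s ⁻¹' Iio (x + 1) ∩ disk, ENNReal.ofReal (s z ^ 2)
        ≤ ∫⁻ z in s ⁻¹' Iio (x + 1) ∩ disk, ENNReal.ofReal ((x + 1) ^ 2) := by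
          refine setLIntegral_mono' ((hsm measurableSet_Iio).inter measurableSet_ball)
            fun z hz => ENNReal.ofReal_le_ofReal ?_
          have h1 : s z < x + 1 := hz.1
          exact pow_le_pow_left₀ (zero_le_one.trans (hs1 z hz.2)) h1.le 2
      _ = ENNReal.ofReal ((x + 1) ^ 2) * volume (s ⁻¹' Iio (x + 1) ∩ disk) := by simp
      _ < ⊤ := ENNReal.mul_lt_top ENNReal.ofReal_lt_top
          ((measure_mono inter_subset_right).trans_lt measure_ball_lt_top)
  have hatom : ∀ v : ℝ, m {v} = 0 := by
    intro v
    rw [hm _ (measurableSet_singleton v)]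
    refine setLIntegral_measure_zero _ _ (measure_mono_null (fun z hz => ?_)
      (Measure.addHaar_sphere volume (0 : ℂ) (1 - v⁻¹)))
    have h1 : (1 - ‖z‖)⁻¹ = v := hz.1
    rw [mem_sphere_zero_iff_norm, ← h1, inv_inv]; ring
  let Q : Set ℝ := range (s ∘ TopologicalSpace.denseSeq ℂ)
  have hQ : m Q = 0 := by
    have : Q = ⋃ n, {s (TopologicalSpace.denseSeq ℂ n)} := by ext; simp [Q, eq_comm]
    rw [this]; exact measure_iUnion_null fun n => hatom _
  have hK : m Q < volume (ball (0 : ℂ) (1 / 2)) := by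
    rw [hQ]; exact measure_ball_pos _ _ (by norm_num)
  obtain ⟨U, hQU, hU, hmU⟩ := Q.exists_isOpen_lt_of_lt _ hK
  have hZm : MeasurableSet (s ⁻¹' U ∩ disk) := (hsm hU.measurableSet).inter measurableSet_ball
  have hmU' := hm U hU.measurableSet
  refine ⟨s ⁻¹' U ∩ disk, inter_subset_right, ?_, ?_, ?_, ?_, ?_⟩
  · have hc : ContinuousOn s disk := by
      refine ContinuousOn.inv₀ (by fun_prop) fun z hz => (hdisk z hz).ne'
    rw [inter_comm]
    exact hc.isOpen_inter_preimage isOpen_ball hU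
  · rintro z ⟨hz1, hz2⟩ w hw
    refine ⟨?_, ?_⟩
    · simpa [s, hw] using hz1
    · rw [mem_ball_zero_iff] at hz2 ⊢
      rwa [hw]
  · intro G hG hne hGd
    obtain ⟨z, hzG, n, rfl⟩ := (TopologicalSpace.denseRange_denseSeq ℂ).inter_open_nonempty G hG hne
    exact ⟨_, hzG, hQU ⟨n, rfl⟩, hGd hzG⟩
  · have hmeas : Measurable fun z : ℂ => (‖1 - z‖ ^ 2)⁻¹ := by fun_prop
    refine ⟨hmeas.aestronglyMeasurable, ?_⟩
    rw [hasFiniteIntegral_iff_ofReal (ae_of_all _ fun z => by positivity)]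
    refine lt_of_le_of_lt ?_ (hmU.trans measure_ball_lt_top)
    rw [hmU']
    refine setLIntegral_mono' hZm fun z hz => ENNReal.ofReal_le_ofReal ?_
    have h1 := hdisk z hz.2
    have h2 := norm_sub_norm_le (1 : ℂ) z
    rw [norm_one] at h2
    simp only [s, inv_pow]
    gcongr
  · intro h0
    have h1 : volume (ball (0 : ℂ) (1 / 2)) ≤ volume (s ⁻¹' U ∩ disk) := by
      calc volume (ball (0 : ℂ) (1 / 2))
          ≤ volume (ball (0 : ℂ) (1 / 2) \ (s ⁻¹' U ∩ disk)) + volume (s ⁻¹' U ∩ disk) := by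
            refine (measure_mono ?_).trans (measure_union_le _ _)
            rw [sdiff_union_self]; exact subset_union_left
        _ = _ := by rw [h0, zero_add]
    refine absurd hmU (not_lt.2 (h1.trans ?_))
    rw [hmU', ← setLIntegral_one]
    refine setLIntegral_mono' hZm fun z hz => ?_
    rw [← ENNReal.ofReal_one]
    exact ENNReal.ofReal_le_ofReal (one_le_pow₀ (hs1 z hz.2))

/-! ### Radial weights of mean zero -/

/-- A bounded radial weight of integral zero, supported in a smaller disk, annihilates all
holomorphic functions on the disk: this is the mean value property on each circle. -/
lemma integral_radial_mul_eq_zero {p : ℂ → ℂ} {F : ℂ → ℂ} {C R : ℝ} (hp : Measurable p)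
    (hC : ∀ z, ‖p z‖ ≤ C) (hrad : ∀ z w, ‖z‖ = ‖w‖ → p z = p w) (hR : R < 1)
    (hsupp : ∀ z, R < ‖z‖ → p z = 0) (hF : DifferentiableOn ℂ F disk) (h0 : ∫ z, p z = 0) :
    ∫ z, p z * F z = 0 := by
  have hcirc : ∀ θ : ℝ, ‖circleMap 0 1 θ‖ = 1 := fun θ => by simp
  have hset : ∀ g : ℂ → ℂ, ∫ z in closedBall 0 R, p z * g z = ∫ z, p z * g z := by
    intro g
    refine setIntegral_eq_integral_of_forall_compl_eq_zero fun z hz => ?_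
    rw [hsupp z (by simpa using hz), zero_mul]
  -- every rotation of `F` has the same integral against `p`
  have hrot : ∀ θ : ℝ, ∫ z in closedBall 0 R, p z * F (circleMap 0 1 θ * z) = ∫ z, p z * F z := by
    intro θ
    rw [hset]
    let c : Circle := ⟨circleMap 0 1 θ, by simp [Submonoid.unitSphere]⟩
    have := (rotation c).measurePreserving.integral_comp
      (rotation c).toHomeomorph.measurableEmbedding (fun z => p z * F z)
    rw [← this]
    refine integral_congr_ae (ae_of_all _ fun z => ?_)
    have h1 : rotation c z = circleMap 0 1 θ * z := by rw [rotation_apply]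
    simp only [h1]
    rw [hrad (circleMap 0 1 θ * z) z (by simp)]
  have hmean : ∀ z ∈ closedBall (0 : ℂ) R,
      ∫ θ in (0 : ℝ)..2 * Real.pi, p z * F (circleMap 0 1 θ * z) = 2 * Real.pi * (p z * F 0) := by
    intro z hz
    rw [mem_closedBall_zero_iff] at hz
    have hd : DiffContOnCl ℂ (fun ζ => F (ζ * z)) (ball 0 |1|) := by
      refine DifferentiableOn.diffContOnCl ?_
      rw [closure_ball _ (by simp), abs_one]
      refine hF.comp (by fun_prop) fun ζ hζ => ?_
      rw [mem_closedBall_zero_iff] at hζ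
      rw [mem_ball_zero_iff, norm_mul]
      nlinarith [norm_nonneg z, norm_nonneg ζ]
    have := hd.circleAverage
    rw [Real.circleAverage_def] at this
    simp only [zero_mul] at this
    rw [intervalIntegral.integral_const_mul, ← this, Complex.real_smul]
    have hpi : (Real.pi : ℂ) ≠ 0 := by exact_mod_cast Real.pi_ne_zero
    push_cast
    field_simp
    simp only [mul_comm]
  have hint : Integrable (Function.uncurry fun (θ : ℝ) (z : ℂ) => p z * F (circleMap 0 1 θ * z))
      ((volume.restrict (Ioc 0 (2 * Real.pi))).prod (volume.restrict (closedBall 0 R))) := by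
    rw [Measure.prod_restrict]
    have hcont : ContinuousOn (fun q : ℝ × ℂ => F (circleMap 0 1 q.1 * q.2))
        (Icc 0 (2 * Real.pi) ×ˢ closedBall 0 R) := by
      refine hF.continuousOn.comp ?_ fun q hq => ?_
      · exact (((continuous_circleMap 0 1).comp continuous_fst).mul continuous_snd).continuousOn
      · have := mem_closedBall_zero_iff.1 hq.2
        rw [mem_ball_zero_iff, norm_mul, hcirc, one_mul]
        linarith
    have h1 : IntegrableOn (fun q : ℝ × ℂ => F (circleMap 0 1 q.1 * q.2))
        (Ioc 0 (2 * Real.pi) ×ˢ closedBall 0 R) (volume.prod volume) :=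
      (hcont.integrableOn_compact (isCompact_Icc.prod (isCompact_closedBall 0 R))).mono_set
        (prod_mono Ioc_subset_Icc_self subset_rfl)
    exact h1.bdd_mul (c := C) (hp.comp measurable_snd).aestronglyMeasurable
      (ae_of_all _ fun q => hC q.2)
  have hswap := integral_integral_swap hint
  have hpi : (0 : ℝ) ≤ 2 * Real.pi := by positivity
  rw [integral_congr_ae (ae_of_all _ hrot)] at hswap
  have h2 : ∫ z in closedBall (0 : ℂ) R, ∫ θ in Ioc 0 (2 * Real.pi), p z * F (circleMap 0 1 θ * z)
      = ∫ z in closedBall (0 : ℂ) R, 2 * Real.pi * (p z * F 0) := by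
    refine setIntegral_congr_fun measurableSet_closedBall fun z hz => ?_
    rw [← intervalIntegral.integral_of_le hpi, hmean z hz]
  rw [h2, integral_const_mul, hset (fun _ => F 0), integral_mul_const, h0] at hswap
  simpa [Real.pi_ne_zero, Measure.real, Real.pi_pos.le] using hswap

/-! ### Differentials directed by the double pole at the boundary point `1` -/

lemma one_sub_re_pos {z : ℂ} (hz : z ∈ disk) : 0 < (1 - z).re := by
  have := Complex.re_le_norm z
  rw [mem_ball_zero_iff] at hz
  simp only [Complex.sub_re, Complex.one_re]; linarith

lemma norm_one_sub_pos {z : ℂ} (hz : z ∈ disk) : 0 < ‖1 - z‖ :=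
  (one_sub_re_pos hz).trans_le (Complex.re_le_norm _)

lemma norm_one_sub_le {z : ℂ} (hz : z ∈ disk) : ‖1 - z‖ ≤ 2 := by
  have h := norm_sub_le (1 : ℂ) z
  rw [mem_ball_zero_iff] at hz
  rw [norm_one] at h
  linarith

/-- The integrable quadratic differential `(1 - z) ^ (ε - 2)` on the disk. -/
noncomputable def cuspDiff (ε : ℝ) (z : ℂ) : ℂ := (1 - z) ^ (ε : ℂ) / (1 - z) ^ 2

lemma norm_cuspDiff (ε : ℝ) {z : ℂ} (hz : z ∈ disk) :
    ‖cuspDiff ε z‖ = ‖1 - z‖ ^ (ε - 2) := by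
  rw [cuspDiff, norm_div, norm_pow, Complex.norm_cpow_real, Real.rpow_sub (norm_one_sub_pos hz),
    Real.rpow_two]

lemma isQuadDiff_cuspDiff {ε : ℝ} (hε : 0 < ε) : IsQuadDiff disk (cuspDiff ε) := by
  have hd : DifferentiableOn ℂ (cuspDiff ε) disk := by
    refine DifferentiableOn.div (DifferentiableOn.cpow (by fun_prop) (by fun_prop) fun z hz => ?_)
      (by fun_prop) fun z hz => ?_
    · exact Or.inl (one_sub_re_pos hz)
    · exact pow_ne_zero 2 (norm_pos_iff.1 (norm_one_sub_pos hz))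
  refine ⟨hd, (integrableOn_disk_norm_rpow hε).mono'
    (hd.continuousOn.aestronglyMeasurable measurableSet_ball) ?_⟩
  filter_upwards [ae_restrict_mem measurableSet_ball] with z hz
  exact (norm_cuspDiff ε hz).le

/-- The unimodular function `φ̄ / |φ|` for the (non-integrable) quadratic differential
`φ = (1 - z)⁻²`. -/
noncomputable def cuspDir (z : ℂ) : ℂ := (1 - z) ^ 2 / (‖1 - z‖ ^ 2 : ℝ)

lemma measurable_cuspDir : Measurable cuspDir := by unfold cuspDir; fun_prop

lemma norm_cuspDir_le (z : ℂ) : ‖cuspDir z‖ ≤ 1 := by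
  rw [cuspDir, norm_div, norm_pow, Complex.norm_real, Real.norm_of_nonneg (by positivity)]
  exact div_self_le_one _

lemma norm_cuspDir {z : ℂ} (hz : z ∈ disk) : ‖cuspDir z‖ = 1 := by
  have := norm_one_sub_pos hz
  rw [cuspDir, norm_div, norm_pow, Complex.norm_real, Real.norm_of_nonneg (by positivity)]
  exact div_self (by positivity)

lemma cuspDir_mul_cuspDiff (ε : ℝ) {z : ℂ} (hz : z ∈ disk) :
    cuspDir z * cuspDiff ε z = (1 - z) ^ (ε : ℂ) / (‖1 - z‖ ^ 2 : ℝ) := by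
  have : 1 - z ≠ 0 := norm_pos_iff.1 (norm_one_sub_pos hz)
  rw [cuspDir, cuspDiff]
  field_simp

/-- Multiplication by `w ^ ε` with `0 < w.re` rotates by an angle of at most `2 ε`. -/
lemma le_re_mul_cpow {w T : ℂ} {ε : ℝ} (hw : 0 < w.re) (hε : 0 ≤ ε) (hT : 0 ≤ T.re) :
    ‖w‖ ^ ε * (T.re * (1 - 2 * ε) - |T.im| * (2 * ε)) ≤ (T * w ^ (ε : ℂ)).re := by
  have harg : |w.arg * ε| ≤ 2 * ε := by
    rw [abs_mul, abs_of_nonneg hε]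
    have h1 := (Complex.abs_arg_lt_pi_div_two_iff.2 (Or.inl hw)).le
    have := Real.pi_lt_four
    gcongr; linarith
  have hcos : 1 - 2 * ε ≤ Real.cos (w.arg * ε) := by
    have := Real.abs_cos_sub_cos_le 0 (w.arg * ε)
    rw [Real.cos_zero, zero_sub, abs_neg] at this
    linarith [le_abs_self (1 - Real.cos (w.arg * ε))]
  have hsin : |Real.sin (w.arg * ε)| ≤ 2 * ε := Real.abs_sin_le_abs.trans harg
  rw [Complex.mul_re, Complex.cpow_ofReal_re, Complex.cpow_ofReal_im]
  have h1 : T.im * Real.sin (w.arg * ε) ≤ |T.im| * (2 * ε) :=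
    (le_abs_self _).trans (by rw [abs_mul]; gcongr)
  have h2 : T.re * (1 - 2 * ε) ≤ T.re * Real.cos (w.arg * ε) := by gcongr
  have h3 : (0 : ℝ) ≤ ‖w‖ ^ ε := by positivity
  nlinarith

/-- The Beltrami differential `g · φ̄ / |φ|` with `φ = (1 - z)⁻²`, for a measurable `g` bounded by
one. -/
noncomputable def twist (g : ℂ → ℂ) (hg : Measurable g) (hb : ∀ z, ‖g z‖ ≤ 1) : Bel disk :=
  (memLp_top_of_bound (hg.mul measurable_cuspDir).aestronglyMeasurable 1 (ae_of_all _ fun z => by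
    rw [Pi.mul_apply, norm_mul]
    exact mul_le_one₀ (hb z) (norm_nonneg _) (norm_cuspDir_le z))).toLp (g * cuspDir)

section twist

variable {g : ℂ → ℂ} (hg : Measurable g) (hb : ∀ z, ‖g z‖ ≤ 1)

lemma twist_ae_eq : ∀ᵐ z ∂volume.restrict disk, twist g hg hb z = g z * cuspDir z :=
  MemLp.coeFn_toLp _

lemma norm_twist_ae_eq : ∀ᵐ z ∂volume.restrict disk, ‖twist g hg hb z‖ = ‖g z‖ := by
  filter_upwards [twist_ae_eq hg hb, ae_restrict_mem measurableSet_ball] with z h hz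
  rw [h, norm_mul, norm_cuspDir hz, mul_one]

lemma norm_twist_le : ‖twist g hg hb‖ ≤ 1 := by
  have : IsFiniteMeasure (volume.restrict disk) :=
    isFiniteMeasure_restrict.2 measure_ball_lt_top.ne
  refine (Lp.norm_le_of_ae_bound (C := 1) zero_le_one ?_).trans ?_
  · filter_upwards [norm_twist_ae_eq hg hb] with z h
    rw [h]; exact hb z
  · simp

end twist

lemma Bel.ae_norm_le {S : Set ℂ} (μ : Bel S) : ∀ᵐ z ∂volume.restrict S, ‖μ z‖ ≤ ‖μ‖ := by
  have h := enorm_ae_le_eLpNormEssSup (μ : ℂ → ℂ) (volume.restrict S)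
  filter_upwards [h] with z hz
  rw [Lp.norm_def, eLpNorm_exponent_top]
  rw [← toReal_enorm]
  refine ENNReal.toReal_mono ?_ hz
  rw [← eLpNorm_exponent_top]; exact Lp.eLpNorm_ne_top μ

lemma Bel.integrableOn_mul {S : Set ℂ} (μ : Bel S) {φ : ℂ → ℂ} (hφ : IntegrableOn φ S) :
    IntegrableOn (fun z => μ z * φ z) S :=
  hφ.bdd_mul (c := ‖μ‖) (Lp.aestronglyMeasurable μ) (Bel.ae_norm_le μ)

lemma re_integral_mul_le {S : Set ℂ} (μ : Bel S) {φ : ℂ → ℂ} (hφ : IntegrableOn φ S) :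
    (∫ z in S, μ z * φ z).re ≤ ‖μ‖ * ∫ z in S, ‖φ z‖ := by
  refine (Complex.re_le_norm _).trans ((norm_integral_le_integral_norm _).trans ?_)
  rw [← integral_const_mul]
  refine integral_mono_ae (Bel.integrableOn_mul μ hφ).norm (hφ.norm.const_mul _) ?_
  filter_upwards [Bel.ae_norm_le μ] with z hz
  rw [norm_mul]; gcongr

lemma bddAbove_classNorm {S : Set ℂ} (μ : Bel S) :
    BddAbove {t : ℝ | ∃ φ : ℂ → ℂ, IsQuadDiff S φ ∧ ∫ z in S, ‖φ z‖ = 1 ∧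
      t = (∫ z in S, μ z * φ z).re} := by
  refine ⟨‖μ‖, ?_⟩
  rintro t ⟨φ, hφ, h1, rfl⟩
  simpa [h1] using re_integral_mul_le μ hφ.2

/-- Every nonzero test differential gives a lower bound for the norm of the class. -/
lemma re_integral_le_classNorm_mul {S : Set ℂ} (μ : Bel S) {φ : ℂ → ℂ} (hφ : IsQuadDiff S φ)
    (h0 : 0 < ∫ z in S, ‖φ z‖) :
    (∫ z in S, μ z * φ z).re ≤ classNorm μ * ∫ z in S, ‖φ z‖ := by
  set N := ∫ z in S, ‖φ z‖ with hN
  rw [← div_le_iff₀ h0]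
  refine le_csSup (bddAbove_classNorm μ) ⟨fun z => (N⁻¹ : ℝ) * φ z,
    ⟨hφ.1.const_mul _, hφ.2.const_mul _⟩, ?_, ?_⟩
  · simp only [norm_mul, Complex.norm_real, Real.norm_of_nonneg (inv_nonneg.2 h0.le)]
    rw [integral_const_mul, ← hN, inv_mul_cancel₀ h0.ne']
  · have : ∀ z, μ z * ((N⁻¹ : ℝ) * φ z) = (N⁻¹ : ℝ) * (μ z * φ z) := fun z => by ring
    simp only [this]
    rw [integral_const_mul, Complex.re_ofReal_mul]
    field_simp

lemma IsExtremal.of_one_le_classNorm {S : Set ℂ} {μ : Bel S} (h1 : ‖μ‖ ≤ 1)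
    (h : 1 ≤ classNorm μ) : IsExtremal μ := by
  refine le_antisymm (h1.trans h) ?_
  refine csSup_le ?_ ?_
  · by_contra hne
    rw [not_nonempty_iff_eq_empty] at hne
    rw [classNorm, hne, Real.sSup_empty] at h
    linarith
  · rintro t ⟨φ, hφ, h1, rfl⟩
    simpa [h1] using re_integral_mul_le μ hφ.2

/-- If `g = 1` off a set on which `(1 - z)⁻²` is integrable, the differentials `(1 - z) ^ (ε - 2)`,
normalised, form a Hamilton sequence as `ε → 0`: their mass escapes to the boundary point `1`, where
`g · φ̄ / |φ|` agrees with their direction up to a rotation of order `ε`. -/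
lemma isExtremal_twist {g : ℂ → ℂ} (hg : Measurable g) (hb : ∀ z, ‖g z‖ ≤ 1) {E : Set ℂ}
    (hE : MeasurableSet E) (hEd : E ⊆ disk)
    (hint : IntegrableOn (fun z : ℂ => (‖1 - z‖ ^ 2)⁻¹) E) (h1 : ∀ z ∈ disk \ E, g z = 1) :
    IsExtremal (twist g hg hb) := by
  set μ := twist g hg hb
  refine .of_one_le_classNorm (norm_twist_le hg hb) ?_
  set M := ∫ z in E, (‖1 - z‖ ^ 2)⁻¹
  have hM : 0 ≤ M := integral_nonneg fun z => by positivity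
  have key : ∀ ε : ℝ, 0 < ε → ε ≤ 1 → 1 - 2 * ε - 4 * M * ε ≤ classNorm μ := by
    intro ε hε hε1
    have hN := le_integral_disk_norm_rpow hε
    set N := ∫ z in disk, ‖1 - z‖ ^ (ε - 2) with hNdef
    have hN0 : 0 < N := (by positivity : 0 < 1 / ε).trans_le hN
    have hnorm : ∫ z in disk, ‖cuspDiff ε z‖ = N :=
      setIntegral_congr_fun measurableSet_ball fun z hz => norm_cuspDiff ε hz
    have hcl := re_integral_le_classNorm_mul μ (isQuadDiff_cuspDiff hε) (by rwa [hnorm])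
    rw [hnorm] at hcl
    have hpt : ∀ᵐ z ∂volume.restrict disk, (1 - 2 * ε) * ‖1 - z‖ ^ (ε - 2) -
        4 * E.indicator (fun z : ℂ => (‖1 - z‖ ^ 2)⁻¹) z ≤ (μ z * cuspDiff ε z).re := by
      filter_upwards [twist_ae_eq hg hb, ae_restrict_mem measurableSet_ball] with z hz hzd
      have hw := norm_one_sub_pos hzd
      by_cases hzE : z ∈ E
      · have h2 : -‖1 - z‖ ^ (ε - 2) ≤ (μ z * cuspDiff ε z).re := by
          refine le_trans ?_ (neg_le_of_abs_le (Complex.abs_re_le_norm _))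
          rw [norm_mul, norm_cuspDiff ε hzd, hz, norm_mul, norm_cuspDir hzd, mul_one]
          have := hb z
          have : 0 ≤ ‖1 - z‖ ^ (ε - 2) := by positivity
          nlinarith
        have h3 : ‖1 - z‖ ^ (ε - 2) ≤ 2 * (‖1 - z‖ ^ 2)⁻¹ := by
          rw [Real.rpow_sub hw, Real.rpow_two, div_eq_mul_inv]
          gcongr
          calc ‖1 - z‖ ^ ε ≤ 2 ^ ε := by gcongr; exact norm_one_sub_le hzd
            _ ≤ 2 := by simpa using Real.rpow_le_rpow_of_exponent_le one_le_two hε1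
        have h4 : 0 ≤ ‖1 - z‖ ^ (ε - 2) := by positivity
        rw [indicator_of_mem hzE]
        nlinarith
      · have h2 := le_re_mul_cpow (T := 1) (one_sub_re_pos hzd) hε.le (by simp)
        rw [hz, h1 z ⟨hzd, hzE⟩, one_mul, cuspDir_mul_cuspDiff ε hzd, indicator_of_notMem hzE,
          Complex.div_ofReal_re, Real.rpow_sub hw, Real.rpow_two, le_div_iff₀ (by positivity)]
        rw [one_mul] at h2
        simp only [Complex.one_re, Complex.one_im, abs_zero] at h2
        field_simp
        linarith
    have hi1 := (integrableOn_disk_norm_rpow hε).const_mul (1 - 2 * ε)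
    have hi2 : IntegrableOn (fun z => 4 * E.indicator (fun z : ℂ => (‖1 - z‖ ^ 2)⁻¹) z) disk :=
      (((integrable_indicator_iff hE).2 hint).integrableOn).const_mul 4
    have hi3 := Bel.integrableOn_mul μ (isQuadDiff_cuspDiff hε).2
    have hle := integral_mono_ae (hi1.sub hi2) hi3.re hpt
    rw [integral_sub' hi1 hi2, integral_const_mul, integral_const_mul, setIntegral_indicator hE,
      inter_eq_right.2 hEd] at hle
    have hre : ∫ z in disk, (μ z * cuspDiff ε z).re = (∫ z in disk, μ z * cuspDiff ε z).re :=
      integral_re hi3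
    have hle' : (1 - 2 * ε) * N - 4 * M ≤ classNorm μ * N := by
      refine le_trans ?_ hcl
      rw [← hre]; exact hle
    have hMN : 4 * M ≤ 4 * M * ε * N := by
      have : 1 ≤ ε * N := by rwa [div_le_iff₀' hε] at hN
      nlinarith
    refine le_of_mul_le_mul_right ?_ hN0
    linarith
  refine le_of_forall_pos_le_add fun δ hδ => ?_
  have := key (min (δ / (2 + 4 * M)) 1) (lt_min (by positivity) one_pos) (min_le_right _ _)
  have h2 : δ / (2 + 4 * M) * (2 + 4 * M) = δ := by field_simp
  have h3 := min_le_left (δ / (2 + 4 * M)) 1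
  nlinarith

/-- A differential `h · φ̄ / |φ|` with `h ≥ 0` is non-decreasable, although `φ = (1 - z)⁻²` is not
integrable. If `ν` is a competitor and `T = (μ - ν) |φ| / φ̄`, then `Re T ≥ 0` and
`|T| ^ 2 ≤ 2 Re T`. Testing with `(1 - z) ^ (ε - 2)` the rotation by `(1 - z) ^ ε` costs only
`O(ε²) ∫ |1 - z| ^ (ε - 2) = O(ε)`, so the weighted integral of `Re T` vanishes. -/
lemma isNonDecreasable_twist {g : ℂ → ℂ} (hg : Measurable g) (hb : ∀ z, ‖g z‖ ≤ 1)
    (hpos : ∀ z, g z = (‖g z‖ : ℝ)) : IsNonDecreasable (twist g hg hb) := by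
  intro ν hν hle
  set μ := twist g hg hb
  set T : ℂ → ℂ := fun z => (μ z - ν z) * (starRingEnd ℂ) (cuspDir z)
  have hTm : AEStronglyMeasurable T (volume.restrict disk) :=
    ((Lp.aestronglyMeasurable μ).sub (Lp.aestronglyMeasurable ν)).mul
      (Complex.continuous_conj.measurable.comp measurable_cuspDir).aestronglyMeasurable
  have hdir : ∀ z ∈ disk, (starRingEnd ℂ) (cuspDir z) * cuspDir z = 1 := by
    intro z hz
    rw [mul_comm, Complex.mul_conj, Complex.normSq_eq_norm_sq, norm_cuspDir hz]; simp
  have hT : ∀ᵐ z ∂volume.restrict disk, 0 ≤ (T z).re ∧ ‖T z‖ ^ 2 ≤ 2 * (T z).re := by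
    filter_upwards [twist_ae_eq hg hb, norm_twist_ae_eq hg hb, hle,
      ae_restrict_mem measurableSet_ball] with z h1 h2 h3 hz
    set b := ν z * (starRingEnd ℂ) (cuspDir z)
    have hbn : ‖b‖ ≤ ‖g z‖ := by
      rw [norm_mul, RCLike.norm_conj, norm_cuspDir hz, mul_one, ← h2]; exact h3
    have hTb : T z = (‖g z‖ : ℝ) - b := by
      rw [← hpos z]
      simp only [T, b, sub_mul]
      rw [show μ z = g z * cuspDir z from h1, mul_assoc, mul_comm (cuspDir z), hdir z hz, mul_one]
    have hbre := (Complex.re_le_norm b).trans hbn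
    have hre : (T z).re = ‖g z‖ - b.re := by rw [hTb, Complex.sub_re, Complex.ofReal_re]
    have him : (T z).im = -b.im := by rw [hTb, Complex.sub_im, Complex.ofReal_im, zero_sub]
    have hb2 : b.re * b.re + b.im * b.im ≤ ‖g z‖ ^ 2 := by
      rw [← Complex.normSq_apply, ← Complex.sq_norm]
      gcongr
    rw [Complex.sq_norm, Complex.normSq_apply, hre, him]
    have := hb z
    have := norm_nonneg (g z)
    constructor
    · linarith
    · nlinarith
  have hT2 : ∀ᵐ z ∂volume.restrict disk, ‖T z‖ ≤ 2 := by
    filter_upwards [hT] with z hz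
    have := Complex.re_le_norm (T z)
    nlinarith [norm_nonneg (T z)]
  have hIT : IntegrableOn (fun z => (T z).re * ‖1 - z‖ ^ ((1 : ℝ) - 2)) disk := by
    refine (integrableOn_disk_norm_rpow one_pos).bdd_mul (c := 2)
      (Complex.continuous_re.comp_aestronglyMeasurable hTm) ?_
    filter_upwards [hT2] with z hz
    exact (Complex.abs_re_le_norm _).trans hz
  have key : ∀ ε : ℝ, 0 < ε → ε ≤ 1 / 4 →
      ∫ z in disk, (T z).re * ‖1 - z‖ ^ ((1 : ℝ) - 2) ≤ 256 * Real.pi * ε := by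
    intro ε hε hε1
    have hq := isQuadDiff_cuspDiff hε
    have hint : IntegrableOn (fun z => (μ z - ν z) * cuspDiff ε z) disk := by
      simp only [sub_mul]
      exact (Bel.integrableOn_mul μ hq.2).sub (Bel.integrableOn_mul ν hq.2)
    have hre : ∫ z in disk, ((μ z - ν z) * cuspDiff ε z).re = 0 := by
      have h1 : ∫ z in disk, ((μ z - ν z) * cuspDiff ε z).re =
        (∫ z in disk, (μ z - ν z) * cuspDiff ε z).re := integral_re hint
      rw [h1, hν _ hq, Complex.zero_re]
    have hpt : ∀ᵐ z ∂volume.restrict disk, 1 / 8 * ((T z).re * ‖1 - z‖ ^ ((1 : ℝ) - 2)) -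
        8 * ε ^ 2 * ‖1 - z‖ ^ (ε - 2) ≤ ((μ z - ν z) * cuspDiff ε z).re := by
      filter_upwards [hT, ae_restrict_mem measurableSet_ball] with z hz hzd
      have hw := norm_one_sub_pos hzd
      have h1 : (μ z - ν z) * cuspDiff ε z =
          T z * (1 - z) ^ (ε : ℂ) / (‖1 - z‖ ^ 2 : ℝ) := by
        rw [mul_div_assoc, ← cuspDir_mul_cuspDiff ε hzd]
        calc _ = (μ z - ν z) * (starRingEnd ℂ (cuspDir z) * cuspDir z) * cuspDiff ε z := by
              rw [hdir z hzd, mul_one]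
          _ = _ := by simp only [T]; ring
      have h2 := le_re_mul_cpow (one_sub_re_pos hzd) hε.le hz.1
      have h3 : (T z).re / 4 - 8 * ε ^ 2 ≤
          (T z).re * (1 - 2 * ε) - |(T z).im| * (2 * ε) := by
        have h4 : |(T z).im| ^ 2 ≤ ‖T z‖ ^ 2 := by
          gcongr; exact Complex.abs_im_le_norm _
        nlinarith [sq_nonneg (|(T z).im| - 8 * ε), hz.1, hz.2]
      -- `‖1 - z‖ ≤ 2` and `ε ≤ 1` give a lower bound that does not depend on `ε`
      have h5 : ‖1 - z‖ / 2 ≤ ‖1 - z‖ ^ ε := by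
        have h6 : ‖1 - z‖ / 2 ≤ 1 := by linarith [norm_one_sub_le hzd]
        have h7 := Real.rpow_le_rpow_of_exponent_ge (by positivity) h6 (by linarith : ε ≤ 1)
        rw [Real.rpow_one] at h7
        exact h7.trans (Real.rpow_le_rpow (by positivity) (by linarith) hε.le)
      rw [h1, Complex.div_ofReal_re, Real.rpow_sub hw, Real.rpow_sub hw, Real.rpow_two,
        Real.rpow_one, le_div_iff₀ (by positivity)]
      have h8 : (1 / 8 * ((T z).re * (‖1 - z‖ / ‖1 - z‖ ^ 2)) -
          8 * ε ^ 2 * (‖1 - z‖ ^ ε / ‖1 - z‖ ^ 2)) * ‖1 - z‖ ^ 2 =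
          1 / 8 * ((T z).re * ‖1 - z‖) - 8 * ε ^ 2 * ‖1 - z‖ ^ ε := by field_simp
      rw [h8]
      have h9 : (0 : ℝ) ≤ ‖1 - z‖ ^ ε := by positivity
      nlinarith [mul_le_mul_of_nonneg_left h3 h9, mul_le_mul_of_nonneg_left h5 hz.1]
    have hi1 := hIT.const_mul (1 / 8)
    have hi2 := (integrableOn_disk_norm_rpow hε).const_mul (8 * ε ^ 2)
    have hle := integral_mono_ae (hi1.sub hi2) hint.re hpt
    rw [integral_sub' hi1 hi2, integral_const_mul, integral_const_mul] at hle
    have hle' := hle.trans_eq hre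
    have hN := integral_disk_norm_rpow_le hε (by linarith)
    rw [le_div_iff₀ hε] at hN
    have combine : ∀ I N : ℝ, 1 / 8 * I - 8 * ε ^ 2 * N ≤ 0 → N * ε ≤ 4 * Real.pi →
        I ≤ 256 * Real.pi * ε := by
      intro I N h1 h2
      nlinarith [mul_le_mul_of_nonneg_left h2 hε.le]
    exact combine _ _ hle' hN
  have hz : ∫ z in disk, (T z).re * ‖1 - z‖ ^ ((1 : ℝ) - 2) = 0 := by
    refine le_antisymm (le_of_forall_pos_le_add fun δ hδ => ?_) (integral_nonneg_of_ae ?_)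
    · have hpi := Real.pi_pos
      have := key (min (δ / (256 * Real.pi)) (1 / 4)) (lt_min (by positivity) (by norm_num))
        (min_le_right _ _)
      have h2 : 256 * Real.pi * (δ / (256 * Real.pi)) = δ := by field_simp
      have h3 := mul_le_mul_of_nonneg_left (min_le_left (δ / (256 * Real.pi)) (1 / 4))
        (by positivity : 0 ≤ 256 * Real.pi)
      rw [zero_add]
      exact this.trans (h3.trans_eq h2)
    · filter_upwards [hT] with z hz
      exact mul_nonneg hz.1 (by positivity)
  rw [integral_eq_zero_iff_of_nonneg_ae ?_ hIT] at hz
  · refine Lp.ext ?_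
    filter_upwards [hz, hT, ae_restrict_mem measurableSet_ball] with z h1 h2 hzd
    have hw := Real.rpow_pos_of_pos (norm_one_sub_pos hzd) ((1 : ℝ) - 2)
    have h3 : (T z).re = 0 := by simpa [hw.ne'] using h1
    have h4 : T z = 0 := by
      rw [h3, mul_zero] at h2
      exact norm_eq_zero.1 (pow_eq_zero_iff two_ne_zero |>.1 (le_antisymm h2.2 (by positivity)))
    have h5 : T z * cuspDir z = μ z - ν z := by
      simp only [T]; rw [mul_assoc, hdir z hzd, mul_one]
    rw [h4, zero_mul] at h5
    exact (sub_eq_zero.1 h5.symm)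
  · filter_upwards [hT] with z hz
    exact mul_nonneg hz.1 (by positivity)

/-! ### A family of equivalent Beltrami differentials -/

/-- The mean of `|z| ^ 2` over the part of `ball 0 (1 / 2)` outside `Z`. -/
noncomputable def sqMean (Z : Set ℂ) : ℝ :=
  (∫ z in ball (0 : ℂ) (1 / 2) \ Z, ‖z‖ ^ 2) / volume.real (ball (0 : ℂ) (1 / 2) \ Z)

open Classical in
/-- The coefficient of `φ̄ / |φ|` in a family of equivalent Beltrami differentials: it vanishes on
`Z`, is `1` off `Z` and `ball 0 (1 / 2)`, and on `ball 0 (1 / 2) \ Z` it equals `1 / 2` plus `c`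
times a real function, whose product with `|φ| = |1 - z|⁻²` is radial of mean zero. -/
noncomputable def coeff (Z : Set ℂ) (c z : ℂ) : ℂ :=
  if z ∈ Z then 0
  else if z ∈ ball (0 : ℂ) (1 / 2) then
    1 / 2 + c * ((‖z‖ ^ 2 - sqMean Z) * ‖1 - z‖ ^ 2 : ℝ)
  else 1

lemma half_ball_subset_disk : ball (0 : ℂ) (1 / 2) ⊆ disk := ball_subset_ball (by norm_num)

lemma volume_half_ball_diff_ne_top (Z : Set ℂ) : volume (ball (0 : ℂ) (1 / 2) \ Z) ≠ ⊤ :=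
  ((measure_mono sdiff_subset).trans_lt measure_ball_lt_top).ne

lemma integrableOn_sq_norm (Z : Set ℂ) :
    IntegrableOn (fun z : ℂ => ‖z‖ ^ 2) (ball (0 : ℂ) (1 / 2) \ Z) :=
  (ContinuousOn.integrableOn_compact (isCompact_closedBall (0 : ℂ) (1 / 2)) (by fun_prop)).mono_set
    (sdiff_subset.trans ball_subset_closedBall)

lemma sq_norm_le {z : ℂ} (hz : z ∈ ball (0 : ℂ) (1 / 2)) : ‖z‖ ^ 2 ≤ 1 / 4 := by
  rw [mem_ball_zero_iff] at hz
  nlinarith [norm_nonneg z]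

namespace IsSparseDense

variable {Z : Set ℂ}

lemma measurableSet_half_ball_diff (hZ : IsSparseDense Z) :
    MeasurableSet (ball (0 : ℂ) (1 / 2) \ Z) :=
  measurableSet_ball.diff hZ.isOpen.measurableSet

lemma measurable_coeff (hZ : IsSparseDense Z) (c : ℂ) : Measurable (coeff Z c) := by
  unfold coeff
  exact Measurable.ite hZ.isOpen.measurableSet measurable_const
    (Measurable.ite measurableSet_ball (by fun_prop) measurable_const)

lemma volume_real_pos (hZ : IsSparseDense Z) : 0 < volume.real (ball (0 : ℂ) (1 / 2) \ Z) :=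
  ENNReal.toReal_pos hZ.volume_ne_zero (volume_half_ball_diff_ne_top Z)

lemma sqMean_mem (hZ : IsSparseDense Z) : sqMean Z ∈ Icc (0 : ℝ) (1 / 4) := by
  refine ⟨div_nonneg (integral_nonneg fun z => by positivity) measureReal_nonneg, ?_⟩
  rw [sqMean, div_le_iff₀ hZ.volume_real_pos]
  have := setIntegral_mono_on (integrableOn_sq_norm Z)
    (integrableOn_const (volume_half_ball_diff_ne_top Z) (C := (1 / 4 : ℝ)))
    hZ.measurableSet_half_ball_diff fun z hz => sq_norm_le hz.1
  rw [setIntegral_const, smul_eq_mul] at this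
  linarith

lemma abs_bump_le (hZ : IsSparseDense Z) {z : ℂ} (hz : z ∈ ball (0 : ℂ) (1 / 2)) :
    |(‖z‖ ^ 2 - sqMean Z) * ‖1 - z‖ ^ 2| ≤ 1 := by
  obtain ⟨h0, h1⟩ := hZ.sqMean_mem
  have h2 := sq_norm_le hz
  have h3 : |‖z‖ ^ 2 - sqMean Z| ≤ 1 / 4 := abs_le.2 ⟨by nlinarith [norm_nonneg z], by linarith⟩
  have h4 := norm_one_sub_le (half_ball_subset_disk hz)
  rw [abs_mul, abs_of_nonneg (by positivity : 0 ≤ ‖1 - z‖ ^ 2)]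
  have h5 : ‖1 - z‖ ^ 2 ≤ 4 := by nlinarith [norm_nonneg (1 - z)]
  calc _ ≤ 1 / 4 * (4 : ℝ) := mul_le_mul h3 h5 (by positivity) (by norm_num)
    _ = 1 := by norm_num

lemma norm_coeff_le (hZ : IsSparseDense Z) {c : ℂ} (hc : ‖c‖ ≤ 1 / 2) (z : ℂ) :
    ‖coeff Z c z‖ ≤ 1 := by
  unfold coeff
  split_ifs with h1 h2
  · simp
  · refine (norm_add_le _ _).trans ?_
    rw [norm_mul, Complex.norm_real, Real.norm_eq_abs]
    have h3 := mul_le_mul hc (hZ.abs_bump_le h2) (abs_nonneg _) (by norm_num)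
    have h4 : ‖(1 / 2 : ℂ)‖ = 1 / 2 := by simp
    rw [h4]; linarith
  · simp

/-- The family of Beltrami differentials with coefficients `coeff Z c`. For `c ≥ 0` they are
non-decreasable; for `c` on the imaginary axis, other than zero, pseudo non-decreasable. -/
noncomputable def family (hZ : IsSparseDense Z) {c : ℂ} (hc : ‖c‖ ≤ 1 / 2) : Bel disk :=
  twist (coeff Z c) (hZ.measurable_coeff c) (hZ.norm_coeff_le hc)

lemma isExtremal_family (hZ : IsSparseDense Z) {c : ℂ} (hc : ‖c‖ ≤ 1 / 2) :
    IsExtremal (hZ.family hc) := by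
  refine isExtremal_twist _ _ (E := Z ∪ ball 0 (1 / 2))
    (hZ.isOpen.measurableSet.union measurableSet_ball)
    (union_subset hZ.subset half_ball_subset_disk) (hZ.integrableOn.union ?_) ?_
  · refine (ContinuousOn.integrableOn_compact (isCompact_closedBall (0 : ℂ) (1 / 2)) ?_).mono_set
      ball_subset_closedBall
    refine ContinuousOn.inv₀ (by fun_prop) fun z hz => ?_
    exact pow_ne_zero 2 (norm_one_sub_pos (closedBall_subset_ball (by norm_num) hz)).ne'
  · rintro z ⟨_, hz⟩
    rw [mem_union, not_or] at hz
    rw [coeff, if_neg hz.1, if_neg hz.2]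

/-- Two members of the family differ by a multiple of `p / φ`, with `p` radial of mean zero, and
`ψ / φ = (1 - z) ^ 2 ψ` is holomorphic. -/
lemma equivalent_family (hZ : IsSparseDense Z) {c d : ℂ} (hc : ‖c‖ ≤ 1 / 2) (hd : ‖d‖ ≤ 1 / 2) :
    Equivalent (hZ.family hc) (hZ.family hd) := by
  intro ψ hψ
  set A := ball (0 : ℂ) (1 / 2) \ Z with hA
  have hAm : MeasurableSet A := hZ.measurableSet_half_ball_diff
  set p : ℂ → ℂ := A.indicator fun z => ((‖z‖ ^ 2 - sqMean Z : ℝ) : ℂ) with hp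
  have h1 : ∀ᵐ z ∂volume.restrict disk, (hZ.family hc z - hZ.family hd z) * ψ z =
      (c - d) * (p z * ((1 - z) ^ 2 * ψ z)) := by
    filter_upwards [twist_ae_eq (hZ.measurable_coeff c) (hZ.norm_coeff_le hc),
      twist_ae_eq (hZ.measurable_coeff d) (hZ.norm_coeff_le hd),
      ae_restrict_mem measurableSet_ball] with z hzc hzd hz
    rw [family, family, hzc, hzd]
    have hw : (‖1 - z‖ : ℂ) ≠ 0 := by exact_mod_cast (norm_one_sub_pos hz).ne'
    by_cases hz1 : z ∈ Z
    · simp [coeff, hz1, hp, hA]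
    by_cases hz2 : z ∈ ball (0 : ℂ) (1 / 2)
    · have hzA : z ∈ A := ⟨hz2, hz1⟩
      rw [hp, indicator_of_mem hzA, coeff, coeff, if_neg hz1, if_neg hz1,
        if_pos hz2, if_pos hz2, cuspDir]
      push_cast
      field_simp
      ring
    · rw [hp, indicator_of_notMem (fun h : z ∈ A => hz2 h.1), coeff, coeff, if_neg hz1, if_neg hz1,
        if_neg hz2, if_neg hz2]
      simp
  have hsupp : ∀ z, 1 / 2 < ‖z‖ → p z = 0 := by
    intro z hz
    refine indicator_of_notMem (fun h => ?_) _
    have := mem_ball_zero_iff.1 h.1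
    linarith
  rw [integral_congr_ae h1, integral_const_mul,
    setIntegral_eq_integral_of_forall_compl_eq_zero fun z hz => ?_,
    integral_radial_mul_eq_zero (C := 1 / 4) (R := 1 / 2) ?_ ?_ ?_ (by norm_num) hsupp ?_ ?_,
    mul_zero]
  · exact Measurable.indicator (by fun_prop) hAm
  · intro z
    by_cases hz : z ∈ A
    · rw [hp, indicator_of_mem hz, Complex.norm_real, Real.norm_eq_abs, abs_le]
      obtain ⟨h0, h1⟩ := hZ.sqMean_mem
      have := sq_norm_le hz.1
      constructor <;> nlinarith [norm_nonneg z]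
    · rw [hp, indicator_of_notMem hz]; norm_num
  · have hrad : ∀ z w : ℂ, ‖z‖ = ‖w‖ → z ∈ A → w ∈ A := by
      rintro z w h ⟨hz1, hz2⟩
      refine ⟨?_, fun hw => hz2 (hZ.mem_of_norm_eq w hw z h)⟩
      rw [mem_ball_zero_iff] at hz1 ⊢
      rwa [← h]
    intro z w h
    by_cases hz : z ∈ A
    · rw [hp, indicator_of_mem hz, indicator_of_mem (hrad z w h hz), h]
    · rw [hp, indicator_of_notMem hz, indicator_of_notMem fun hw => hz (hrad w z h.symm hw)]
  · exact DifferentiableOn.mul (by fun_prop) hψ.1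
  · rw [hp, integral_indicator hAm, integral_complex_ofReal,
      integral_sub (integrableOn_sq_norm Z) (integrableOn_const (volume_half_ball_diff_ne_top Z)),
      setIntegral_const, smul_eq_mul, sqMean, ← hA, mul_div_cancel₀ _ hZ.volume_real_pos.ne',
      sub_self, Complex.ofReal_zero]
  · rw [hsupp z, zero_mul]
    have : 1 ≤ ‖z‖ := by simpa using hz
    linarith

/-- The perturbation in `coeff` vanishes only on a circle, so the parameter can be recovered. -/
lemma family_injective (hZ : IsSparseDense Z) {c d : ℂ} (hc : ‖c‖ ≤ 1 / 2) (hd : ‖d‖ ≤ 1 / 2)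
    (h : hZ.family hc = hZ.family hd) : c = d := by
  by_contra hne
  refine hZ.volume_ne_zero (measure_mono_null_ae (t := sphere (0 : ℂ) √(sqMean Z)) ?_
    (Measure.addHaar_sphere volume _ _))
  have h1 := twist_ae_eq (hZ.measurable_coeff c) (hZ.norm_coeff_le hc)
  have h2 := twist_ae_eq (hZ.measurable_coeff d) (hZ.norm_coeff_le hd)
  rw [ae_restrict_iff' measurableSet_ball] at h1 h2
  filter_upwards [h1, h2] with z hz1 hz2 hz
  have hzd := half_ball_subset_disk hz.1
  have h3 : coeff Z c z * cuspDir z = coeff Z d z * cuspDir z := by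
    rw [← hz1 hzd, ← hz2 hzd]
    exact congrArg (fun μ : Bel disk => μ z) h
  have hdir : cuspDir z ≠ 0 := norm_pos_iff.1 (by rw [norm_cuspDir hzd]; exact one_pos)
  have h4 := mul_right_cancel₀ hdir h3
  rw [coeff, coeff, if_neg hz.2, if_neg hz.2, if_pos hz.1, if_pos hz.1] at h4
  have h5 : (c - d) * ((‖z‖ ^ 2 - sqMean Z) * ‖1 - z‖ ^ 2 : ℝ) = 0 := by linear_combination h4
  rcases mul_eq_zero.1 h5 with h6 | h6
  · exact absurd (sub_eq_zero.1 h6) hne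
  · have h7 : ‖z‖ ^ 2 - sqMean Z = 0 := by
      rcases mul_eq_zero.1 (Complex.ofReal_eq_zero.1 h6) with h | h
      · exact h
      · exact absurd h (pow_ne_zero 2 (norm_one_sub_pos hzd).ne')
    change z ∈ sphere (0 : ℂ) _
    rw [mem_sphere_zero_iff_norm, ← sub_eq_zero.1 h7, Real.sqrt_sq (norm_nonneg z)]

lemma isNonDecreasable_family (hZ : IsSparseDense Z) {t : ℝ} (h0 : 0 ≤ t)
    (ht : ‖(t : ℂ)‖ ≤ 1 / 2) : IsNonDecreasable (hZ.family ht) := by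
  refine isNonDecreasable_twist _ _ fun z => ?_
  have hreal : ∃ r : ℝ, 0 ≤ r ∧ coeff Z t z = r := by
    unfold coeff
    split_ifs with h1 h2
    · exact ⟨0, le_rfl, by simp⟩
    · refine ⟨1 / 2 + t * ((‖z‖ ^ 2 - sqMean Z) * ‖1 - z‖ ^ 2), ?_, by push_cast; ring⟩
      have h3 := (abs_le.1 (hZ.abs_bump_le h2)).1
      rw [Complex.norm_real, Real.norm_of_nonneg h0] at ht
      nlinarith
    · exact ⟨1, zero_le_one, by simp⟩
  obtain ⟨r, hr, hz⟩ := hreal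
  rw [hz, Complex.norm_real, Real.norm_of_nonneg hr]

/-- A member of the family vanishes on `Z`, which has positive area in every nonempty open subset of
the disk. -/
lemma isWeaklyNonDecreasable_family (hZ : IsSparseDense Z) {c : ℂ} (hc : ‖c‖ ≤ 1 / 2) :
    IsWeaklyNonDecreasable (hZ.family hc) := by
  rintro ⟨ν, _, _, G, hGd, hG, hGc, δ, hδ, hle⟩
  have hpos : volume (G ∩ Z) ≠ 0 :=
    ((hG.inter hZ.isOpen).measure_pos volume (hZ.dense G hG hGc.nonempty hGd)).ne'
  refine hpos (measure_eq_zero_iff_ae_notMem.2 ?_)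
  rw [ae_restrict_iff' hG.measurableSet] at hle
  have h1 := norm_twist_ae_eq (hZ.measurable_coeff c) (hZ.norm_coeff_le hc)
  rw [ae_restrict_iff' measurableSet_ball] at h1
  filter_upwards [hle, h1] with z h2 h3 hz
  have h4 := h2 hz.1
  rw [family, h3 (hGd hz.1), coeff, if_pos hz.2, norm_zero] at h4
  linarith [norm_nonneg (ν z)]

lemma isPseudoNonDecreasable_family (hZ : IsSparseDense Z) {t : ℝ} (h0 : t ≠ 0)
    (ht : ‖(t * Complex.I : ℂ)‖ ≤ 1 / 2) : IsPseudoNonDecreasable (hZ.family ht) := by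
  refine ⟨hZ.isWeaklyNonDecreasable_family ht, fun hnd => ?_⟩
  have hz : ‖(0 : ℂ)‖ ≤ 1 / 2 := by simp
  -- dropping the imaginary part of the coefficient decreases the modulus
  have := hZ.family_injective ht hz (hnd _ (hZ.equivalent_family ht hz) ?_)
  · simp [h0] at this
  filter_upwards [norm_twist_ae_eq (hZ.measurable_coeff 0) (hZ.norm_coeff_le hz),
    norm_twist_ae_eq (hZ.measurable_coeff (t * Complex.I)) (hZ.norm_coeff_le ht)] with z h1 h2
  rw [family, family, h1, h2]
  unfold coeff
  split_ifs with h3 h4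
  · exact le_rfl
  · refine le_trans (le_of_eq ?_) (Complex.re_le_norm _)
    rw [Complex.add_re, mul_assoc, Complex.re_ofReal_mul, mul_comm Complex.I,
      Complex.re_ofReal_mul]
    simp
  · exact le_rfl

end IsSparseDense

end InfTeich

theorem theorem4 :
    ∃ μ : InfTeich.Bel InfTeich.disk,
      InfTeich.IsExtremal μ ∧
      {ν : InfTeich.Bel InfTeich.disk | ν ∈ InfTeich.eqClass μ ∧
        InfTeich.IsExtremal ν ∧ InfTeich.IsNonDecreasable ν}.Infinite ∧
      {ν : InfTeich.Bel InfTeich.disk | ν ∈ InfTeich.eqClass μ ∧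
        InfTeich.IsExtremal ν ∧ InfTeich.IsPseudoNonDecreasable ν}.Infinite := by
  obtain ⟨Z, hZ⟩ := InfTeich.exists_isSparseDense
  have hz : ‖(0 : ℂ)‖ ≤ 1 / 2 := by simp
  let t : ℕ → ℝ := fun n => 1 / ((n : ℝ) + 2)
  have ht0 : ∀ n, 0 < t n := fun n => by positivity
  have ht1 : ∀ n, t n ≤ 1 / 2 := fun n =>
    one_div_le_one_div_of_le two_pos (by linarith [(Nat.cast_nonneg n : (0 : ℝ) ≤ n)])
  have htinj : Function.Injective t := by
    intro m n h
    have h1 : (m : ℝ) + 2 = n + 2 := by simpa [t] using h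
    exact_mod_cast add_right_cancel h1
  have hre : ∀ n, ‖(t n : ℂ)‖ ≤ 1 / 2 := fun n => by
    rw [Complex.norm_real, Real.norm_of_nonneg (ht0 n).le]; exact ht1 n
  have him : ∀ n, ‖(t n * Complex.I : ℂ)‖ ≤ 1 / 2 := fun n => by
    rw [norm_mul, Complex.norm_I, mul_one]; exact hre n
  refine ⟨hZ.family hz, hZ.isExtremal_family hz, ?_, ?_⟩
  · refine Set.infinite_of_injective_forall_mem (f := fun n => hZ.family (hre n)) ?_ fun n =>
      ⟨hZ.equivalent_family _ _, hZ.isExtremal_family _, hZ.isNonDecreasable_family (ht0 n).le _⟩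
    intro m n h
    exact htinj (Complex.ofReal_injective (hZ.family_injective _ _ h))
  · refine Set.infinite_of_injective_forall_mem (f := fun n => hZ.family (him n)) ?_ fun n =>
      ⟨hZ.equivalent_family _ _, hZ.isExtremal_family _,
        hZ.isPseudoNonDecreasable_family (ht0 n).ne' _⟩
    intro m n h
    exact htinj (Complex.ofReal_injective
      (mul_right_cancel₀ Complex.I_ne_zero (hZ.family_injective _ _ h)))
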